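/- Conventions. A (nondegenerate) spherical tetrahedron is spanned by four linearly independent unit vectors $w_1,\dots,w_4\in\mathbb R^4$; its edge lengths are the geodesic distances $l_{ij}=\arccos\langle w_i,w_j\rangle$, and its spherical Gram determinant is $G=\det(\cos l_{ij})$ (with $1$ on the diagonal). Its exterior dihedral angle at the edge $w_aw_b$ is $\pi$ minus the angle between the components of the other two vertices orthogonal to $\mathrm{span}(w_a,w_b)$; it depends only on the six edge lengths. (1) **Asymptotic pentagon identity.** Let $v_0,\dots,v_4\in S^3\subset\mathbb R^4$ be such that for every $i$ the four points $v_j$, $j\ne i$, span a nondegenerate spherical tetrahedron $S_i$, and let $G_i$ be its Gram determinant. Orient $S_i$ as a face of the abstract 4-simplex, i.e. by $(-1)^i[v_0,\dots,\widehat{v_i},\dots,v_4]$, fix an orientation of $S^3$, and let $s_i=\pm1$ according to whether the embedding of $S_i$ in $S^3$ preserves or reverses orientation. Let $l_{ij}$ be the distance of $v_i$ and $v_j$. With the signs $s_j$ fixed, let $$\omega_{04}=\sum_{j=1}^3 s_j(\pi-\theta^j_{04}),$$ where $\theta^j_{04}$ is the exterior dihedral angle of $S_j$ at the edge $e_{04}$,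 regarded as a function of the ten edge lengths $l_{ij}$. If $S_0$ and $S_4$ meet exactly in their common face $v_1v_2v_3$ (as in the 2-3 move), then at the edge lengths of the given configuration $\omega_{04}$ is differentiable in $l_{04}$, the other nine lengths being fixed, and $$\frac{\partial\omega_{04}}{\partial l_{04}}=s_1s_2s_3\,\sin^2(l_{04})\sqrt{\frac{G_0G_4}{G_1G_2G_3}}.$$ Without this assumption on $S_0$ and $S_4$ the derivative exists as well, and the same formula holds with the right-hand side multiplied by $s_0s_4$. (2) **Asymptotic normalization identity.** Let $l_{ij}$ be the edge lengths of a nondegenerate spherical tetrahedron, and let $l_{ab}$, $l_{cd}$ be the lengths of two opposite edges. Fix the five lengths other than $l_{ab}$, and let $l_{ab}$ run over the set of all values for which a nondegenerate spherical tetrahedron with these edge lengths exists. Over this set, $\sin(l_{ab})/\sqrt{G}$ is integrable, and $$\sin(l_{cd})\int\frac{\sin(l_{ab})}{\sqrt{G}}\,dl_{ab}=\pi .$$ -/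

import Mathlib

open Real

noncomputable section

/-- The ambient Euclidean space `ℝ⁴` of the unit sphere `S³`. -/
abbrev E4 : Type := EuclideanSpace ℝ (Fin 4)

/-- Spherical edge lengths (geodesic distances on the unit sphere) between points `v i`,
as a function of the unordered pair of vertices. -/
def edgeLength {n : ℕ} (v : Fin n → E4) : Sym2 (Fin n) → ℝ :=
  Sym2.lift ⟨fun i j => InnerProductGeometry.angle (v i) (v j),
    fun i j => InnerProductGeometry.angle_comm (v i) (v j)⟩

/-- Four points of `S³` spanning a nondegenerate spherical tetrahedron. -/
def IsSphericalTetrahedron (w : Fin 4 → E4) : Prop :=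
  (∀ i, ‖w i‖ = 1) ∧ LinearIndependent ℝ w

/-- `w` spans a nondegenerate spherical tetrahedron with the edge lengths `l`. Only the values
of `l` at the six pairs of distinct vertices matter. -/
def HasEdgeLengths (w : Fin 4 → E4) (l : Sym2 (Fin 4) → ℝ) : Prop :=
  IsSphericalTetrahedron w ∧ ∀ i j, i ≠ j → edgeLength w s(i, j) = l s(i, j)

/-- There is a nondegenerate spherical tetrahedron with the edge lengths `l`. -/
def TetrahedronExists (l : Sym2 (Fin 4) → ℝ) : Prop :=
  ∃ w : Fin 4 → E4, HasEdgeLengths w l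

/-- The determinant of the spherical Gram matrix `(cos l_ij)`, with `1` on the diagonal. -/
def gramDet (l : Sym2 (Fin 4) → ℝ) : ℝ :=
  Matrix.det (Matrix.of fun i j : Fin 4 => if i = j then (1 : ℝ) else cos (l s(i, j)))

/-- The exterior dihedral angle of the spherical tetrahedron `w` at its edge `w a, w b`, where
`w c, w d` are the two other vertices: `π` minus the angle between the components of `w c` and
`w d` orthogonal to the plane spanned by the edge. -/
def exteriorDihedral (w : Fin 4 → E4) (a b c d : Fin 4) : ℝ :=
  π - InnerProductGeometry.angle
    ((Submodule.span ℝ {w a, w b})ᗮ.starProjection (w c))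
    ((Submodule.span ℝ {w a, w b})ᗮ.starProjection (w d))

open Classical in
/-- The exterior dihedral angle as a function of the six edge lengths: its value in a spherical
tetrahedron with these edge lengths, which is unique up to isometries of `S³`
(and `0` if there is none). -/
def exteriorDihedralOfLengths (l : Sym2 (Fin 4) → ℝ) (a b c d : Fin 4) : ℝ :=
  if h : TetrahedronExists l then exteriorDihedral h.choose a b c d else 0

/-- The vertices of the tetrahedron `S_i`: all of `v 0, …, v 4` except `v i`, in order. -/
def omitVertex (v : Fin 5 → E4) (i : Fin 5) : Fin 4 → E4 := fun k => v (i.succAbove k)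

/-- The lengths of the six edges of the tetrahedron `S_i`, out of the ten edge lengths. -/
def omitLengths (l : Sym2 (Fin 5) → ℝ) (i : Fin 5) : Sym2 (Fin 4) → ℝ :=
  fun e => l (Sym2.map i.succAbove e)

/-- The sign of the embedded tetrahedron `S_j`. The complex is oriented as the boundary of
the 4-simplex, i.e. `S_j` carries the orientation `(-1) ^ j [v_0, …, v_j omitted, …, v_4]`;
the sign tells whether that orientation agrees with the orientation of `S³`. The unit `o`
stands for the choice of one of the two orientations of `S³`. -/
def orientationSign (o : ℤˣ) (v : Fin 5 → E4) (j : Fin 5) : ℝ :=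
  Real.sign (((o : ℤ) : ℝ) * (-1) ^ (j : ℕ) *
    Matrix.det (Matrix.of fun i k : Fin 4 => omitVertex v j i k))

/-- The defect angle around the edge `e_04` as a function of the ten edge lengths, with
fixed signs `s`: the sum of `s_j (π - θ_j)` over the three tetrahedra `S_1, S_2, S_3` that
contain this edge, where `θ_j` is the exterior dihedral angle of `S_j` there. In `S_j` the
vertices `v_0` and `v_4` have the positions `0` and `3`. -/
def defectAngle (s : Fin 5 → ℝ) (l : Sym2 (Fin 5) → ℝ) : ℝ :=
  ∑ j ∈ ({1, 2, 3} : Finset (Fin 5)),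
    s j * (π - exteriorDihedralOfLengths (omitLengths l j) 0 3 1 2)

/-- The spherical simplex with the given vertices, as a subset of `S³`: the points of the
unit sphere in the convex cone generated by the vertices. -/
def sphericalSimplex {n : ℕ} (v : Fin n → E4) : Set E4 :=
  {x | ‖x‖ = 1 ∧ ∃ c : Fin n → ℝ, (∀ i, 0 ≤ c i) ∧ x = ∑ i, c i • v i}

end

/-! Both identities come from splitting `ℝ⁴` into the plane of one edge and its orthogonal
complement; `spanInner` and `perpInner` express the two parts of an inner product through cosines of
edge lengths.

Normalization: split along the edge `cd`. Let `k` be the inner product of the in-plane components of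
the other two vertices, and `r` the product of the lengths of their orthogonal components. Then `G =
sin² l_cd · (r² - (cos l_ab - k)²)` by `gramDet_eq_poly`, and a length in `[0, π]` is admissible
exactly when `|cos l_ab - k| < r` (`tetrahedronExists_update_iff`). Hence `arccos ((cos l_ab - k) /
r) / sin l_cd` is an antiderivative of the integrand. Its numerator is the interior dihedral angle
at `cd`, which runs from `0` to `π`.

Pentagon: write `v_m = a_m v_0 + b_m v_4 + z_m` for `m = 1, 2, 3`, with `z_m` orthogonal to `v_0`
and `v_4`. The coordinate determinants of `S_1, S_2, S_3` are `D c_j`, where `D² = sin² l_04` and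
`c_j` is the planar determinant of the two `z_m` with `m ≠ j`; those of `S_0, S_4` are `D P` and `D
Q`, where `P`, `Q` are the combinations `a_1 c_1 - a_2 c_2 + a_3 c_3` and `b_1 c_1 - b_2 c_2 + b_3
c_3`. Each angle derivative is explicit with denominator `|c_j|`
(`hasDerivAt_pi_sub_exteriorDihedralOfLengths`). The signs `s_j` turn `|c_j|` into `c_j` up to a
common factor, and `c_1 z_1 - c_2 z_2 + c_3 z_3 = 0` collapses the sum to `P Q / (c_1 c_2 c_3)`
(`sum_angle_derivatives_eq`). Since each `G_i` is a squared determinant, this is the formula with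
the factor `s_0 s_4`, which is `1` when `S_0` and `S_4` meet only in their common face. -/

/-! ### Gram determinants and coordinate determinants -/

/-- The Gram matrix of unit vectors is the product of their coordinate matrix with its transpose. -/
theorem gramDet_eq_det_sq {w : Fin 4 → E4} {l : Sym2 (Fin 4) → ℝ} (hw : ∀ i, ‖w i‖ = 1)
    (hl : ∀ i j, i ≠ j → inner ℝ (w i) (w j) = cos (l s(i, j))) :
    gramDet l = (Matrix.of fun i k : Fin 4 => w i k).det ^ 2 := by
  rw [sq]
  nth_rewrite 2 [← Matrix.det_transpose]
  rw [← Matrix.det_mul, gramDet]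
  congr 1
  ext i j
  have h : inner ℝ (w i) (w j) = ∑ k, w i k * w j k := by
    simp [PiLp.inner_apply, mul_comm]
  rw [Matrix.mul_apply]
  simp only [Matrix.of_apply, Matrix.transpose_apply]
  rw [← h]
  split_ifs with hij
  · subst hij; rw [real_inner_self_eq_norm_sq, hw]; norm_num
  · rw [hl i j hij]

theorem linearIndependent_iff_det_coord_ne_zero (w : Fin 4 → E4) :
    LinearIndependent ℝ w ↔ (Matrix.of fun i k : Fin 4 => w i k).det ≠ 0 := by
  rw [← isUnit_iff_ne_zero, ← Matrix.isUnit_iff_isUnit_det,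
    ← Matrix.linearIndependent_rows_iff_isUnit,
    ← LinearMap.linearIndependent_iff (WithLp.linearEquiv 2 ℝ (Fin 4 → ℝ)).toLinearMap
      (LinearEquiv.ker _)]
  rfl

theorem inner_eq_cos_edgeLength {n : ℕ} {v : Fin n → E4} {i j : Fin n} (hi : ‖v i‖ = 1)
    (hj : ‖v j‖ = 1) : inner ℝ (v i) (v j) = cos (edgeLength v s(i, j)) := by
  simp [edgeLength, InnerProductGeometry.cos_angle, hi, hj]

theorem HasEdgeLengths.inner_eq {w : Fin 4 → E4} {l : Sym2 (Fin 4) → ℝ} (h : HasEdgeLengths w l)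
    {i j : Fin 4} (hij : i ≠ j) : inner ℝ (w i) (w j) = cos (l s(i, j)) := by
  rw [inner_eq_cos_edgeLength (h.1.1 i) (h.1.1 j), h.2 i j hij]

theorem HasEdgeLengths.mem_Icc {w : Fin 4 → E4} {l : Sym2 (Fin 4) → ℝ} (h : HasEdgeLengths w l)
    {i j : Fin 4} (hij : i ≠ j) : l s(i, j) ∈ Set.Icc 0 π := by
  rw [← h.2 i j hij]
  exact ⟨InnerProductGeometry.angle_nonneg _ _, InnerProductGeometry.angle_le_pi _ _⟩

theorem HasEdgeLengths.gramDet_eq {w : Fin 4 → E4} {l : Sym2 (Fin 4) → ℝ}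
    (h : HasEdgeLengths w l) : gramDet l = (Matrix.of fun i k : Fin 4 => w i k).det ^ 2 :=
  gramDet_eq_det_sq h.1.1 fun _ _ => h.inner_eq

theorem HasEdgeLengths.gramDet_pos {w : Fin 4 → E4} {l : Sym2 (Fin 4) → ℝ}
    (h : HasEdgeLengths w l) : 0 < gramDet l := by
  rw [h.gramDet_eq]
  have := (linearIndependent_iff_det_coord_ne_zero w).1 h.1.2
  positivity

theorem hasEdgeLengths_of_inner {w : Fin 4 → E4} {l : Sym2 (Fin 4) → ℝ} (hw : ∀ i, ‖w i‖ = 1)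
    (hl : ∀ i j, i ≠ j → inner ℝ (w i) (w j) = cos (l s(i, j)))
    (hmem : ∀ i j, i ≠ j → l s(i, j) ∈ Set.Icc 0 π) (hG : gramDet l ≠ 0) :
    HasEdgeLengths w l := by
  refine ⟨⟨hw, ?_⟩, fun i j hij => ?_⟩
  · rw [linearIndependent_iff_det_coord_ne_zero]
    rw [gramDet_eq_det_sq hw hl] at hG
    exact fun h => hG (by rw [h]; norm_num)
  · simp only [edgeLength, Sym2.lift_mk, InnerProductGeometry.angle, hw, hl i j hij, mul_one, div_one]
    exact arccos_cos (hmem i j hij).1 (hmem i j hij).2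

/-! ### Components along and orthogonal to the plane of an edge -/

/-- The inner product of the components of two vectors in the plane spanned by unit vectors `e`
and `f`, where `x = ⟪e, f⟫`, `p, q` are the inner products of the first vector with `e, f`, and
`p', q'` those of the second. -/
noncomputable def spanInner (x p q p' q' : ℝ) : ℝ :=
  (p * p' + q * q' - x * (p * q' + q * p')) / (1 - x ^ 2)

/-- The inner product of the components orthogonal to the plane of `spanInner`, of two vectors
with inner product `g`. -/
noncomputable def perpInner (x g p q p' q' : ℝ) : ℝ := g - spanInner x p q p' q'

theorem inner_starProjection_orthogonal_span_pair {e f : E4} (he : ‖e‖ = 1) (hf : ‖f‖ = 1)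
    (hx : 1 - (inner ℝ e f) ^ 2 ≠ 0) (u v : E4) :
    inner ℝ ((Submodule.span ℝ {e, f})ᗮ.starProjection u)
      ((Submodule.span ℝ {e, f})ᗮ.starProjection v) =
    perpInner (inner ℝ e f) (inner ℝ u v) (inner ℝ e u) (inner ℝ f u)
      (inner ℝ e v) (inner ℝ f v) := by
  have hee : inner ℝ e e = (1 : ℝ) := by rw [real_inner_self_eq_norm_sq, he]; norm_num
  have hff : inner ℝ f f = (1 : ℝ) := by rw [real_inner_self_eq_norm_sq, hf]; norm_num
  have hfe : inner ℝ f e = inner ℝ e f := real_inner_comm _ _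
  -- The coefficients of the in-plane part come from inverting the Gram matrix of `e, f`, whose
  -- determinant is `1 - ⟪e, f⟫²`.
  have key : ∀ z : E4, (Submodule.span ℝ {e, f})ᗮ.starProjection z =
      z - (((inner ℝ e z - inner ℝ e f * inner ℝ f z) / (1 - (inner ℝ e f) ^ 2)) • e +
        ((inner ℝ f z - inner ℝ e f * inner ℝ e z) / (1 - (inner ℝ e f) ^ 2)) • f) := by
    intro z
    rw [Submodule.starProjection_orthogonal_val]
    congr 1
    apply Submodule.eq_starProjection_of_mem_of_inner_eq_zero
    · exact Submodule.mem_span_pair.2 ⟨_, _, rfl⟩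
    · intro w hw
      obtain ⟨a, b, rfl⟩ := Submodule.mem_span_pair.1 hw
      simp only [inner_sub_left, inner_add_left, inner_add_right, inner_smul_left,
        inner_smul_right, real_inner_comm z, hee, hff, hfe, RCLike.conj_to_real]
      rw [real_inner_comm e z, real_inner_comm f z]
      field_simp
      ring
  rw [key, key, perpInner, spanInner]
  simp only [inner_sub_left, inner_add_left, inner_sub_right, inner_add_right, inner_smul_left,
    inner_smul_right, hee, hff, hfe, RCLike.conj_to_real, real_inner_comm e u, real_inner_comm f u]
  field_simp
  ring

theorem one_sub_inner_sq_pos_of_linearIndependent {e f : E4} (he : ‖e‖ = 1) (hf : ‖f‖ = 1)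
    (h : LinearIndependent ℝ ![e, f]) : 0 < 1 - (inner ℝ e f) ^ 2 := by
  have hz : f - (inner ℝ e f : ℝ) • e ≠ 0 := by
    intro hz
    have := LinearIndependent.pair_iff.1 h (-(inner ℝ e f : ℝ)) 1
      (by rw [← hz, neg_smul, one_smul]; abel)
    exact one_ne_zero this.2
  have hn : ‖f - (inner ℝ e f : ℝ) • e‖ ^ 2 = 1 - (inner ℝ e f) ^ 2 := by
    rw [norm_sub_sq_real, norm_smul, he, hf, inner_smul_right, real_inner_comm, norm_eq_abs,
      mul_one, sq_abs]
    ring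
  rw [← hn]
  have := norm_pos_iff.2 hz
  positivity

theorem LinearIndependent.pair_of_ne {n : ℕ} {w : Fin n → E4} (h : LinearIndependent ℝ w)
    {i j : Fin n} (hij : i ≠ j) : LinearIndependent ℝ ![w i, w j] := by
  have := h.comp ![i, j] (by intro a b; fin_cases a <;> fin_cases b <;> simp [hij, hij.symm])
  convert this using 1
  ext k : 1
  fin_cases k <;> rfl

/-! ### The Gram determinant and existence as functions of one edge length -/

/-- Schur complement of the block of vertices 2 and 3: the second factor is the Gram determinant of
the components of vertices 0 and 1 orthogonal to that edge. It exhibits the dependence on `x` as a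
single square. -/
theorem gramDet_eq_poly (l : Sym2 (Fin 4) → ℝ) {x c p q p' q' : ℝ}
    (h01 : cos (l s(0, 1)) = x) (h23 : cos (l s(2, 3)) = c) (h02 : cos (l s(0, 2)) = p)
    (h03 : cos (l s(0, 3)) = q) (h12 : cos (l s(1, 2)) = p') (h13 : cos (l s(1, 3)) = q')
    (hc : 1 - c ^ 2 ≠ 0) :
    gramDet l = (1 - c ^ 2) * (perpInner c 1 p q p q * perpInner c 1 p' q' p' q' -
      (x - spanInner c p q p' q') ^ 2) := by
  have e1 : (s(1, 0) : Sym2 (Fin 4)) = s(0, 1) := Sym2.eq_swap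
  have e2 : (s(2, 0) : Sym2 (Fin 4)) = s(0, 2) := Sym2.eq_swap
  have e3 : (s(3, 0) : Sym2 (Fin 4)) = s(0, 3) := Sym2.eq_swap
  have e4 : (s(2, 1) : Sym2 (Fin 4)) = s(1, 2) := Sym2.eq_swap
  have e5 : (s(3, 1) : Sym2 (Fin 4)) = s(1, 3) := Sym2.eq_swap
  have e6 : (s(3, 2) : Sym2 (Fin 4)) = s(2, 3) := Sym2.eq_swap
  have hm : (Matrix.of fun i j : Fin 4 => if i = j then (1 : ℝ) else cos (l s(i, j))) =
      !![1, x, p, q; x, 1, p', q'; p, p', 1, c; q, q', c, 1] := by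
    ext i j
    fin_cases i <;> fin_cases j <;> simp [*]
  rw [gramDet, hm]
  simp only [perpInner, spanInner]
  rw [Matrix.det_succ_row_zero]
  simp [Fin.sum_univ_succ, Matrix.det_fin_three, Fin.succAbove]
  field_simp
  ring

/-- Relabelling invariance lets the edge 01 and its opposite edge 23 stand for any pair of opposite
edges. -/
theorem gramDet_comp_map (l : Sym2 (Fin 4) → ℝ) (σ : Equiv.Perm (Fin 4)) :
    gramDet (l ∘ Sym2.map σ) = gramDet l := by
  unfold gramDet
  rw [← Matrix.det_submatrix_equiv_self σ
    (Matrix.of fun i j : Fin 4 => if i = j then (1 : ℝ) else cos (l s(i, j)))]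
  congr 1
  ext i j
  simp

theorem HasEdgeLengths.comp {w : Fin 4 → E4} {l : Sym2 (Fin 4) → ℝ} (h : HasEdgeLengths w l)
    (σ : Equiv.Perm (Fin 4)) : HasEdgeLengths (w ∘ σ) (l ∘ Sym2.map σ) :=
  ⟨⟨fun i => h.1.1 (σ i), h.1.2.comp σ σ.injective⟩,
    fun i j hij => h.2 (σ i) (σ j) (σ.injective.ne hij)⟩

theorem tetrahedronExists_comp_map (l : Sym2 (Fin 4) → ℝ) (σ : Equiv.Perm (Fin 4)) :
    TetrahedronExists (l ∘ Sym2.map σ) ↔ TetrahedronExists l := by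
  refine ⟨fun ⟨w, hw⟩ => ⟨w ∘ σ.symm, ?_⟩, fun ⟨w, hw⟩ => ⟨w ∘ σ, hw.comp σ⟩⟩
  have := hw.comp σ.symm
  rwa [Function.comp_assoc, ← Sym2.map_comp, Equiv.self_comp_symm, Sym2.map_id,
    Function.comp_id] at this

theorem update_comp_map {m n : ℕ} (l : Sym2 (Fin n) → ℝ) {f : Fin m → Fin n}
    (hf : Function.Injective f) (i j : Fin m) (t : ℝ) :
    Function.update l s(f i, f j) t ∘ Sym2.map f =
      Function.update (l ∘ Sym2.map f) s(i, j) t :=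
  Function.update_comp_eq_of_injective l (Sym2.map.injective hf) s(i, j) t

/-- Gram–Schmidt in the order 2, 3, 0, 1 gives explicit coordinates. The squared pivots are `1`, `1
- c²`, `A` and `B - (x - k)² / A`; the last is positive because the Gram determinant is. -/
theorem tetrahedronExists_of_gramDet_pos {l : Sym2 (Fin 4) → ℝ} {x c p q p' q' : ℝ}
    (h01 : cos (l s(0, 1)) = x) (h23 : cos (l s(2, 3)) = c) (h02 : cos (l s(0, 2)) = p)
    (h03 : cos (l s(0, 3)) = q) (h12 : cos (l s(1, 2)) = p') (h13 : cos (l s(1, 3)) = q')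
    (hmem : ∀ i j, i ≠ j → l s(i, j) ∈ Set.Icc 0 π)
    (hc : 0 < 1 - c ^ 2) (ha : 0 < perpInner c 1 p q p q) (hG : 0 < gramDet l) :
    TetrahedronExists l := by
  set A := perpInner c 1 p q p q with hA
  set B := perpInner c 1 p' q' p' q' with hB
  set k := spanInner c p q p' q' with hk
  have hpoly := gramDet_eq_poly l h01 h23 h02 h03 h12 h13 hc.ne'
  rw [← hA, ← hB, ← hk] at hpoly
  have hAB : 0 < A * B - (x - k) ^ 2 := by
    rw [hpoly] at hG
    exact (mul_pos_iff_of_pos_left hc).1 hG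
  have hη : 0 < B - (x - k) ^ 2 / A := by
    have : B - (x - k) ^ 2 / A = (A * B - (x - k) ^ 2) / A := by field_simp
    rw [this]; positivity
  obtain ⟨s, hs, hs2⟩ : ∃ s : ℝ, 0 < s ∧ s ^ 2 = 1 - c ^ 2 := ⟨_, sqrt_pos.2 hc, sq_sqrt hc.le⟩
  obtain ⟨ρ, hρ, hρ2⟩ : ∃ s : ℝ, 0 < s ∧ s ^ 2 = A := ⟨_, sqrt_pos.2 ha, sq_sqrt ha.le⟩
  obtain ⟨η, hη, hη2⟩ : ∃ s : ℝ, 0 < s ∧ s ^ 2 = B - (x - k) ^ 2 / A :=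
    ⟨_, sqrt_pos.2 hη, sq_sqrt hη.le⟩
  have e1 : p ^ 2 + ((q - p * c) / s) ^ 2 + ρ ^ 2 = 1 := by
    rw [hρ2, hA, perpInner, spanInner, div_pow, hs2]; field_simp; ring
  have e2 : p' ^ 2 + ((q' - p' * c) / s) ^ 2 + ((x - k) / ρ) ^ 2 + η ^ 2 = 1 := by
    rw [hη2, div_pow, div_pow, hρ2, hs2, hB, perpInner, spanInner]; field_simp; ring
  have e3 : p * p' + ((q - p * c) / s) * ((q' - p' * c) / s) + ρ * ((x - k) / ρ) = x := by
    rw [mul_div_cancel₀ _ hρ.ne', div_mul_div_comm, ← sq, hs2, hk, spanInner]; field_simp; ring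
  have e4 : p * c + (q - p * c) / s * s = q := by field_simp; ring
  have e5 : p' * c + (q' - p' * c) / s * s = q' := by field_simp; ring
  let w : Fin 4 → E4 := ![!₂[p, (q - p * c) / s, ρ, 0], !₂[p', (q' - p' * c) / s, (x - k) / ρ, η],
    !₂[1, 0, 0, 0], !₂[c, s, 0, 0]]
  have hinner : ∀ u v : E4, inner ℝ u v = u 0 * v 0 + u 1 * v 1 + u 2 * v 2 + u 3 * v 3 := by
    intro u v
    simp [PiLp.inner_apply, Fin.sum_univ_four, mul_comm]
  have hself : ∀ i, inner ℝ (w i) (w i) = (1 : ℝ) := by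
    intro i
    rw [hinner]
    fin_cases i <;> simp [w] <;> linarith
  have hlt : ∀ i j, i < j → inner ℝ (w i) (w j) = cos (l s(i, j)) := by
    intro i j hij
    rw [hinner]
    clear hk
    fin_cases i <;> fin_cases j <;> first | exact absurd hij (by decide) | simp [w, *]
  refine ⟨w, hasEdgeLengths_of_inner (fun i => ?_) (fun i j hij => ?_) hmem hG.ne'⟩
  · have := hself i
    rw [real_inner_self_eq_norm_sq] at this
    exact (pow_eq_one_iff_of_nonneg (norm_nonneg _) two_ne_zero).1 this
  · rcases lt_or_gt_of_ne hij with h | h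
    · exact hlt i j h
    · rw [real_inner_comm, Sym2.eq_swap]; exact hlt j i h

theorem HasEdgeLengths.perpInner_nonneg {w : Fin 4 → E4} {l : Sym2 (Fin 4) → ℝ}
    (h : HasEdgeLengths w l) {i j k : Fin 4} (hij : i ≠ j) (hik : k ≠ i) (hjk : k ≠ j) :
    0 ≤ perpInner (cos (l s(i, j))) 1 (cos (l s(k, i))) (cos (l s(k, j)))
      (cos (l s(k, i))) (cos (l s(k, j))) := by
  have h0 := one_sub_inner_sq_pos_of_linearIndependent (h.1.1 i) (h.1.1 j) (h.1.2.pair_of_ne hij)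
  have := inner_starProjection_orthogonal_span_pair (h.1.1 i) (h.1.1 j) h0.ne' (w k) (w k)
  rw [real_inner_self_eq_norm_sq, real_inner_self_eq_norm_sq, h.1.1 k, h.inner_eq hij,
    real_inner_comm, h.inner_eq hik, real_inner_comm, h.inner_eq hjk, one_pow] at this
  rw [← this]; positivity

theorem HasEdgeLengths.sin_pos {w : Fin 4 → E4} {l : Sym2 (Fin 4) → ℝ}
    (h : HasEdgeLengths w l) {i j : Fin 4} (hij : i ≠ j) : 0 < sin (l s(i, j)) := by
  have h0 := one_sub_inner_sq_pos_of_linearIndependent (h.1.1 i) (h.1.1 j) (h.1.2.pair_of_ne hij)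
  rw [h.inner_eq hij, ← sin_sq] at h0
  exact lt_of_le_of_ne (sin_nonneg_of_mem_Icc (h.mem_Icc hij)) (sq_pos_iff.1 h0).symm

theorem tetrahedronExists_update_iff {l : Sym2 (Fin 4) → ℝ} (h : TetrahedronExists l) :
    ∃ k r : ℝ, 0 < r ∧ 0 < sin (l s(2, 3)) ∧ ∀ t,
      (TetrahedronExists (Function.update l s(0, 1) t) ↔
        t ∈ Set.Icc 0 π ∧ |cos t - k| < r) ∧
      gramDet (Function.update l s(0, 1) t) =
        sin (l s(2, 3)) ^ 2 * (r ^ 2 - (cos t - k) ^ 2) := by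
  have ne2 : (s(2, 3) : Sym2 (Fin 4)) ≠ s(0, 1) := by decide
  have ne3 : (s(0, 2) : Sym2 (Fin 4)) ≠ s(0, 1) := by decide
  have ne4 : (s(0, 3) : Sym2 (Fin 4)) ≠ s(0, 1) := by decide
  have ne5 : (s(1, 2) : Sym2 (Fin 4)) ≠ s(0, 1) := by decide
  have ne6 : (s(1, 3) : Sym2 (Fin 4)) ≠ s(0, 1) := by decide
  obtain ⟨w, hw⟩ := h
  have hs := hw.sin_pos (i := 2) (j := 3) (by decide)
  have hc : 0 < 1 - cos (l s(2, 3)) ^ 2 := by rw [← sin_sq]; positivity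
  have hG := hw.gramDet_pos
  rw [gramDet_eq_poly l rfl rfl rfl rfl rfl rfl hc.ne', mul_pos_iff_of_pos_left hc] at hG
  have hA := hw.perpInner_nonneg (i := 2) (j := 3) (k := 0) (by decide) (by decide) (by decide)
  have hB := hw.perpInner_nonneg (i := 2) (j := 3) (k := 1) (by decide) (by decide) (by decide)
  set A := perpInner (cos (l s(2, 3))) 1 (cos (l s(0, 2))) (cos (l s(0, 3)))
    (cos (l s(0, 2))) (cos (l s(0, 3))) with hAdef
  set B := perpInner (cos (l s(2, 3))) 1 (cos (l s(1, 2))) (cos (l s(1, 3)))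
    (cos (l s(1, 2))) (cos (l s(1, 3)))
  set k := spanInner (cos (l s(2, 3))) (cos (l s(0, 2))) (cos (l s(0, 3)))
    (cos (l s(1, 2))) (cos (l s(1, 3)))
  -- Positivity of the Gram determinant at the given length says `(cos l_01 - k)² < A * B`; with `0
  -- ≤ B` this also forces `0 < A`.
  have hAB : 0 < A * B := by have := sq_nonneg (cos (l s(0, 1)) - k); linarith
  have hApos : 0 < A := pos_of_mul_pos_left hAB hB
  have hgram : ∀ t, gramDet (Function.update l s(0, 1) t) =
      sin (l s(2, 3)) ^ 2 * (√(A * B) ^ 2 - (cos t - k) ^ 2) := by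
    intro t
    rw [gramDet_eq_poly (Function.update l s(0, 1) t) (x := cos t) (by simp)
      (by rw [Function.update_of_ne ne2]) (by rw [Function.update_of_ne ne3])
      (by rw [Function.update_of_ne ne4]) (by rw [Function.update_of_ne ne5])
      (by rw [Function.update_of_ne ne6]) hc.ne', sq_sqrt hAB.le, sin_sq]
  refine ⟨k, √(A * B), sqrt_pos.2 hAB, hs, fun t => ⟨⟨?_, ?_⟩, hgram t⟩⟩
  · rintro ⟨w', hw'⟩
    have h1 := hw'.mem_Icc (i := 0) (j := 1) (by decide)
    rw [Function.update_self] at h1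
    have h2 := hw'.gramDet_pos
    rw [hgram, mul_pos_iff_of_pos_left (by positivity)] at h2
    exact ⟨h1, abs_lt_of_sq_lt_sq (by linarith) (sqrt_nonneg _)⟩
  · rintro ⟨h1, h2⟩
    refine tetrahedronExists_of_gramDet_pos (x := cos t) (by simp)
      (by rw [Function.update_of_ne ne2]) (by rw [Function.update_of_ne ne3])
      (by rw [Function.update_of_ne ne4]) (by rw [Function.update_of_ne ne5])
      (by rw [Function.update_of_ne ne6]) (fun i j hij => ?_) hc hApos ?_
    · by_cases h : s(i, j) = s(0, 1)
      · rw [h, Function.update_self]; exact h1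
      · rw [Function.update_of_ne h]; exact hw.mem_Icc hij
    · rw [hgram]
      have := sq_lt_sq.2 (h2.trans_eq (abs_of_nonneg (sqrt_nonneg _)).symm)
      have h3 : 0 < √(A * B) ^ 2 - (cos t - k) ^ 2 := by linarith
      positivity

theorem TetrahedronExists.update_self {l : Sym2 (Fin 4) → ℝ} (h : TetrahedronExists l)
    (e : Sym2 (Fin 4)) : TetrahedronExists (Function.update l e (l e)) := by
  rwa [Function.update_eq_self]

theorem TetrahedronExists.sin_pos_of_update {l : Sym2 (Fin 4) → ℝ} {i j : Fin 4} {t : ℝ}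
    (h : TetrahedronExists (Function.update l s(i, j) t)) (hij : i ≠ j) : 0 < sin t := by
  obtain ⟨w, hw⟩ := h
  have := hw.sin_pos hij
  rwa [Function.update_self] at this

/-- Each edge length varies over an interval when the other five lengths are fixed. -/
theorem setOf_tetrahedronExists_update_eq_Ioo {l : Sym2 (Fin 4) → ℝ} (h : TetrahedronExists l) :
    ∃ k r : ℝ, 0 < r ∧ -1 ≤ k - r ∧ k + r ≤ 1 ∧ 0 < sin (l s(2, 3)) ∧
      {t | TetrahedronExists (Function.update l s(0, 1) t)} =
        Set.Ioo (arccos (k + r)) (arccos (k - r)) ∧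
      ∀ t, gramDet (Function.update l s(0, 1) t) =
        sin (l s(2, 3)) ^ 2 * (r ^ 2 - (cos t - k) ^ 2) := by
  obtain ⟨k, r, hr, hs, H⟩ := tetrahedronExists_update_iff h
  have hself := ((H _).1.1 (h.update_self s(0, 1))).2
  rw [abs_lt] at hself
  have h1 : k + r ≤ 1 := by
    -- If `k + r` exceeded `1`, the length `0` would be admissible, although the sine of an edge
    -- length is positive. The length `π` plays the same role at the other end.
    by_contra! hlt
    have := (H 0).1.2 ⟨⟨le_rfl, pi_nonneg⟩, by
      rw [cos_zero, abs_lt]; constructor <;> linarith [cos_le_one (l s(0, 1))]⟩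
    simpa using this.sin_pos_of_update (by decide)
  have h2 : -1 ≤ k - r := by
    by_contra! hlt
    have := (H π).1.2 ⟨⟨pi_nonneg, le_rfl⟩, by
      rw [cos_pi, abs_lt]; constructor <;> linarith [neg_one_le_cos (l s(0, 1))]⟩
    simpa using this.sin_pos_of_update (by decide)
  refine ⟨k, r, hr, h2, h1, hs, ?_, fun t => (H t).2⟩
  have hc1 : cos (arccos (k + r)) = k + r := cos_arccos (by linarith) h1
  have hc2 : cos (arccos (k - r)) = k - r := cos_arccos h2 (by linarith)
  have m1 : arccos (k + r) ∈ Set.Icc 0 π := ⟨arccos_nonneg _, arccos_le_pi _⟩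
  have m2 : arccos (k - r) ∈ Set.Icc 0 π := ⟨arccos_nonneg _, arccos_le_pi _⟩
  ext t
  rw [Set.mem_ofPred_eq, (H t).1, abs_lt, Set.mem_Ioo]
  refine ⟨fun ⟨ht, h3, h4⟩ => ?_, fun ⟨h3, h4⟩ => ?_⟩
  · exact ⟨(strictAntiOn_cos.lt_iff_gt ht m1).1 (by rw [hc1]; linarith),
      (strictAntiOn_cos.lt_iff_gt m2 ht).1 (by rw [hc2]; linarith)⟩
  · have ht : t ∈ Set.Icc 0 π := ⟨m1.1.trans h3.le, h4.le.trans m2.2⟩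
    have h5 := strictAntiOn_cos m1 ht h3
    have h6 := strictAntiOn_cos ht m2 h4
    rw [hc1] at h5
    rw [hc2] at h6
    exact ⟨ht, by linarith, by linarith⟩

/-! ### The normalization integral -/

theorem integral_sin_div_sqrt_gramDet_update {l : Sym2 (Fin 4) → ℝ} (h : TetrahedronExists l) :
    MeasureTheory.IntegrableOn
        (fun t => sin t / √(gramDet (Function.update l s(0, 1) t)))
        {t : ℝ | TetrahedronExists (Function.update l s(0, 1) t)} ∧
      sin (l s(2, 3)) *
        (∫ t in {t : ℝ | TetrahedronExists (Function.update l s(0, 1) t)},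
          sin t / √(gramDet (Function.update l s(0, 1) t))) = π := by
  obtain ⟨k, r, hr, h2, h1, hs, hset, hgram⟩ := setOf_tetrahedronExists_update_eq_Ioo h
  have hab : arccos (k + r) ≤ arccos (k - r) := antitone_arccos (by linarith)
  have hc1 : cos (arccos (k + r)) = k + r := cos_arccos (by linarith) h1
  have hc2 : cos (arccos (k - r)) = k - r := cos_arccos h2 (by linarith)
  have hmem : ∀ t ∈ Set.Ioo (arccos (k + r)) (arccos (k - r)),
      0 < sin t ∧ 0 < r ^ 2 - (cos t - k) ^ 2 := by
    intro t ht
    rw [← hset] at ht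
    have hG : 0 < gramDet (Function.update l s(0, 1) t) := by
      obtain ⟨w, hw⟩ := ht
      exact hw.gramDet_pos
    rw [hgram, mul_pos_iff_of_pos_left (by positivity)] at hG
    exact ⟨TetrahedronExists.sin_pos_of_update ht (by decide), hG⟩
  rw [hset]
  set f := fun t => sin t / √(gramDet (Function.update l s(0, 1) t)) with hf
  have hcont : Continuous fun t => arccos ((cos t - k) / r) / sin (l s(2, 3)) := by fun_prop
  have hderiv : ∀ t ∈ Set.Ioo (arccos (k + r)) (arccos (k - r)),
      HasDerivAt (fun t => arccos ((cos t - k) / r) / sin (l s(2, 3))) (f t) t := by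
    intro t ht
    have hpos := (hmem t ht).2
    have hu : 1 - ((cos t - k) / r) ^ 2 = (r ^ 2 - (cos t - k) ^ 2) / r ^ 2 := by field_simp
    have hu0 : 0 < 1 - ((cos t - k) / r) ^ 2 := by rw [hu]; positivity
    have hd := ((hasDerivAt_arccos (x := (cos t - k) / r) (by rintro h0; simp [h0] at hu0)
      (by rintro h0; simp [h0] at hu0)).comp t
      (((hasDerivAt_cos t).sub_const k).div_const r)).div_const (sin (l s(2, 3)))
    refine hd.congr_deriv ?_
    rw [hf, hu, sqrt_div hpos.le, sqrt_sq hr.le]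
    simp only
    rw [hgram, sqrt_mul (by positivity), sqrt_sq hs.le]
    have := sqrt_pos.2 hpos
    field_simp
  -- The integrand need not stay bounded at the endpoints; integrability holds because it is the
  -- nonnegative derivative of a function continuous up to them.
  have hint := intervalIntegral.integrableOn_deriv_of_nonneg hcont.continuousOn hderiv
    fun t ht => div_nonneg (hmem t ht).1.le (sqrt_nonneg _)
  refine ⟨hint.mono_set Set.Ioo_subset_Ioc_self, ?_⟩
  rw [← MeasureTheory.integral_Ioc_eq_integral_Ioo, ← intervalIntegral.integral_of_le hab,
    intervalIntegral.integral_eq_sub_of_hasDerivAt_of_le hab hcont.continuousOn hderiv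
      ((intervalIntegrable_iff_integrableOn_Ioc_of_le hab).2 hint), hc1, hc2]
  have e1 : (k - r - k) / r = -1 := by field_simp; ring
  have e2 : (k + r - k) / r = 1 := by field_simp; ring
  rw [e1, e2, arccos_neg_one, arccos_one]
  field_simp
  ring

theorem exists_perm_of_nodup {a b c d : Fin 4} (h : [a, b, c, d].Nodup) :
    ∃ σ : Equiv.Perm (Fin 4), σ 0 = a ∧ σ 1 = b ∧ σ 2 = c ∧ σ 3 = d := by
  have hinj : Function.Injective ![a, b, c, d] := by revert a b c d; decide
  exact ⟨Equiv.ofBijective _ hinj.bijective_of_finite, rfl, rfl, rfl, rfl⟩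

theorem integral_sin_div_sqrt_gramDet_update_of_nodup {l : Sym2 (Fin 4) → ℝ}
    (h : TetrahedronExists l) {a b c d : Fin 4} (hnd : [a, b, c, d].Nodup) :
    MeasureTheory.IntegrableOn
        (fun t => sin t / √(gramDet (Function.update l s(a, b) t)))
        {t : ℝ | TetrahedronExists (Function.update l s(a, b) t)} ∧
      sin (l s(c, d)) *
        (∫ t in {t : ℝ | TetrahedronExists (Function.update l s(a, b) t)},
          sin t / √(gramDet (Function.update l s(a, b) t))) = π := by
  obtain ⟨σ, rfl, rfl, rfl, rfl⟩ := exists_perm_of_nodup hnd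
  have := integral_sin_div_sqrt_gramDet_update ((tetrahedronExists_comp_map l σ).2 h)
  simp only [← update_comp_map l σ.injective, tetrahedronExists_comp_map, gramDet_comp_map] at this
  exact this

/-- Near an admissible length the dihedral angle is therefore never the default value `0`, so its
closed formula can be differentiated. -/
theorem isOpen_setOf_tetrahedronExists_update {l : Sym2 (Fin 4) → ℝ} (h : TetrahedronExists l)
    {a b c d : Fin 4} (hnd : [a, b, c, d].Nodup) :
    IsOpen {t | TetrahedronExists (Function.update l s(a, b) t)} := by
  obtain ⟨σ, rfl, rfl, rfl, rfl⟩ := exists_perm_of_nodup hnd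
  obtain ⟨k, r, -, -, -, -, hset, -⟩ :=
    setOf_tetrahedronExists_update_eq_Ioo ((tetrahedronExists_comp_map l σ).2 h)
  simp only [← update_comp_map l σ.injective, tetrahedronExists_comp_map] at hset
  rw [hset]
  exact isOpen_Ioo

/-! ### Derivative of a dihedral angle in the length of its own edge -/

/-- The cosine of the interior dihedral angle at an edge is a quotient of the quantities
`perpInner` of the edge. -/
theorem exteriorDihedralOfLengths_eq {l : Sym2 (Fin 4) → ℝ} (h : TetrahedronExists l)
    {a b c d : Fin 4} (hnd : [a, b, c, d].Nodup) :
    exteriorDihedralOfLengths l a b c d = π - arccos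
      (perpInner (cos (l s(a, b))) (cos (l s(c, d))) (cos (l s(a, c))) (cos (l s(b, c)))
          (cos (l s(a, d))) (cos (l s(b, d))) /
        (√(perpInner (cos (l s(a, b))) 1 (cos (l s(a, c))) (cos (l s(b, c)))
            (cos (l s(a, c))) (cos (l s(b, c)))) *
          √(perpInner (cos (l s(a, b))) 1 (cos (l s(a, d))) (cos (l s(b, d)))
            (cos (l s(a, d))) (cos (l s(b, d)))))) := by
  simp only [List.nodup_cons, List.mem_cons, List.not_mem_nil, or_false, not_or, not_false_eq_true,
    List.nodup_nil, and_true] at hnd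
  obtain ⟨⟨hab, hac, had⟩, ⟨hbc, hbd⟩, hcd⟩ := hnd
  rw [exteriorDihedralOfLengths, dif_pos h, exteriorDihedral]
  have hw := h.choose_spec
  set w := h.choose
  have h0 := one_sub_inner_sq_pos_of_linearIndependent (hw.1.1 a) (hw.1.1 b) (hw.1.2.pair_of_ne hab)
  have key := inner_starProjection_orthogonal_span_pair (hw.1.1 a) (hw.1.1 b) h0.ne'
  rw [InnerProductGeometry.angle, norm_eq_sqrt_real_inner, norm_eq_sqrt_real_inner, key, key, key,
    real_inner_self_eq_norm_sq, real_inner_self_eq_norm_sq, hw.1.1 c, hw.1.1 d,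
    hw.inner_eq hab, hw.inner_eq hac, hw.inner_eq had, hw.inner_eq hbc, hw.inner_eq hbd,
    hw.inner_eq hcd, one_pow]

/-- With `M = !![1, x; x, 1]`, `spanInner` is the bilinear form of `M⁻¹`. The fixed inner products
are `M (a, b)` and `M (a', b')`, so differentiating `M⁻¹` gives minus the form of `M'` on `(a, b)`
and `(a', b')`. -/
theorem hasDerivAt_perpInner {x : ℝ} (hx : 1 - x ^ 2 ≠ 0) (g a b a' b' : ℝ) :
    HasDerivAt (fun z => perpInner z g (a + b * x) (a * x + b) (a' + b' * x) (a' * x + b'))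
      (a * b' + b * a') x := by
  unfold perpInner spanInner
  have h1 := (((hasDerivAt_id x).mul_const ((a + b * x) * (a' * x + b') +
    (a * x + b) * (a' + b' * x))).const_sub ((a + b * x) * (a' + b' * x) +
    (a * x + b) * (a' * x + b'))).div (((hasDerivAt_id x).pow 2).const_sub 1) hx
  refine (h1.const_sub g).congr_deriv ?_
  simp
  field_simp
  ring

theorem perpInner_combination {x : ℝ} (hx : 1 - x ^ 2 ≠ 0) (a b a' b' n : ℝ) :
    perpInner x (a * a' + b * b' + x * (a * b' + b * a') + n) (a + b * x) (a * x + b)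
      (a' + b' * x) (a' * x + b') = n := by
  unfold perpInner spanInner
  field_simp
  ring

theorem hasDerivAt_arccos_div_sqrt {n A B : ℝ → ℝ} {n' A' B' x : ℝ} (hn : HasDerivAt n n' x)
    (hA : HasDerivAt A A' x) (hB : HasDerivAt B B' x) (hA0 : 0 < A x) (hB0 : 0 < B x)
    (hpos : 0 < A x * B x - n x ^ 2) :
    HasDerivAt (fun z => arccos (n z / (√(A z) * √(B z))))
      ((n x * (A' / A x + B' / B x) / 2 - n') / √(A x * B x - n x ^ 2)) x := by
  have hα := sqrt_pos.2 hA0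
  have hβ := sqrt_pos.2 hB0
  have hα2 := sq_sqrt hA0.le
  have hβ2 := sq_sqrt hB0.le
  have hu : 1 - (n x / (√(A x) * √(B x))) ^ 2 =
      (A x * B x - n x ^ 2) / (√(A x) * √(B x)) ^ 2 := by
    rw [div_pow, mul_pow, hα2, hβ2]; field_simp
  have hu0 : 0 < 1 - (n x / (√(A x) * √(B x))) ^ 2 := by rw [hu]; positivity
  have hd := (hasDerivAt_arccos (x := n x / (√(A x) * √(B x))) (by rintro h0; simp [h0] at hu0)
    (by rintro h0; simp [h0] at hu0)).comp x
    (hn.div ((hA.sqrt hA0.ne').mul (hB.sqrt hB0.ne')) (mul_pos hα hβ).ne')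
  refine hd.congr_deriv ?_
  rw [hu, sqrt_div hpos.le, sqrt_sq (mul_pos hα hβ).le]
  have hδ := sqrt_pos.2 hpos
  simp only [Pi.mul_apply]
  generalize √(A x * B x - n x ^ 2) = δ at *
  generalize √(A x) = α at *
  generalize √(B x) = β at *
  rw [← hα2, ← hβ2]
  field_simp
  ring

theorem exists_orthonormal_complement {e f : E4} (h : LinearIndependent ℝ ![e, f]) :
    ∃ u v : E4, ‖u‖ = 1 ∧ ‖v‖ = 1 ∧ inner ℝ u v = (0 : ℝ) ∧ inner ℝ e u = (0 : ℝ) ∧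
      inner ℝ e v = (0 : ℝ) ∧ inner ℝ f u = (0 : ℝ) ∧ inner ℝ f v = (0 : ℝ) ∧
      ∀ z : E4, ∃ a b x y : ℝ, z = a • e + b • f + x • u + y • v := by
  set K := Submodule.span ℝ {e, f} with hK
  have hrank : Module.finrank ℝ Kᗮ = 2 := by
    have h1 := Submodule.finrank_add_finrank_orthogonal K
    have h2 := finrank_span_eq_card h
    rw [Matrix.range_cons_cons_empty, ← hK, Fintype.card_fin] at h2
    rw [h2, finrank_euclideanSpace_fin] at h1
    omega
  let B := (stdOrthonormalBasis ℝ Kᗮ).reindex (finCongr hrank)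
  have he : e ∈ K := Submodule.subset_span (by simp)
  have hf : f ∈ K := Submodule.subset_span (by simp)
  refine ⟨B 0, B 1, B.norm_eq_one 0, B.norm_eq_one 1, B.inner_eq_zero (by decide),
    (B 0).2 e he, (B 1).2 e he, (B 0).2 f hf, (B 1).2 f hf, fun z => ?_⟩
  obtain ⟨a, b, hab⟩ := Submodule.mem_span_pair.1 (K.starProjection_apply_mem z)
  obtain ⟨r, hr⟩ : ∃ r : Fin 2 → ℝ, Kᗮ.starProjection z = r 0 • (B 0 : E4) + r 1 • (B 1 : E4) := by
    have := congrArg Subtype.val (B.sum_repr ⟨_, Kᗮ.starProjection_apply_mem z⟩)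
    rw [Fin.sum_univ_two] at this
    exact ⟨_, this.symm⟩
  refine ⟨a, b, r 0, r 1, ?_⟩
  rw [hab, add_assoc, ← hr, Submodule.starProjection_orthogonal_val]
  abel

theorem det_coord_sum_smul (C : Matrix (Fin 4) (Fin 4) ℝ) (F : Fin 4 → E4) {w : Fin 4 → E4}
    (hw : ∀ i, w i = ∑ m, C i m • F m) :
    (Matrix.of fun i k : Fin 4 => w i k).det = C.det * (Matrix.of fun i k : Fin 4 => F i k).det := by
  rw [← Matrix.det_mul]
  congr 1
  ext i k
  simp [hw, Matrix.mul_apply]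

/-- The Gram matrix is block diagonal, with identity block on `u, v`. -/
theorem det_coord_sq_of_orthonormal_complement {e f u v : E4} (he : ‖e‖ = 1) (hf : ‖f‖ = 1)
    (hu : ‖u‖ = 1) (hv : ‖v‖ = 1) (huv : inner ℝ u v = (0 : ℝ)) (heu : inner ℝ e u = (0 : ℝ))
    (hev : inner ℝ e v = (0 : ℝ)) (hfu : inner ℝ f u = (0 : ℝ)) (hfv : inner ℝ f v = (0 : ℝ)) :
    (Matrix.of fun i k : Fin 4 => (![e, f, u, v] : Fin 4 → E4) i k).det ^ 2 =
      1 - (inner ℝ e f) ^ 2 := by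
  have hn : ∀ i, ‖(![e, f, u, v] : Fin 4 → E4) i‖ = 1 := by
    intro i; fin_cases i <;> simpa
  have hl := fun i j => inner_eq_cos_edgeLength (hn i) (hn j)
  rw [← gramDet_eq_det_sq hn fun i j _ => hl i j,
    gramDet_eq_poly _ (hl 0 1).symm (hl 2 3).symm (hl 0 2).symm (hl 0 3).symm (hl 1 2).symm
      (hl 1 3).symm]
  all_goals simp [perpInner, spanInner, *]

theorem hasDerivAt_pi_sub_exteriorDihedralOfLengths {w : Fin 4 → E4} {l : Sym2 (Fin 4) → ℝ}
    (hw : HasEdgeLengths w l) {u v : E4} (hu : ‖u‖ = 1) (hv : ‖v‖ = 1)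
    (huv : inner ℝ u v = (0 : ℝ)) (heu : inner ℝ (w 0) u = (0 : ℝ))
    (hev : inner ℝ (w 0) v = (0 : ℝ)) (hfu : inner ℝ (w 3) u = (0 : ℝ))
    (hfv : inner ℝ (w 3) v = (0 : ℝ)) {a b x y a' b' x' y' : ℝ}
    (h1 : w 1 = a • w 0 + b • w 3 + x • u + y • v)
    (h2 : w 2 = a' • w 0 + b' • w 3 + x' • u + y' • v)
    (hc : x * y' - y * x' ≠ 0) :
    HasDerivAt (fun t => π - exteriorDihedralOfLengths (Function.update l s(0, 3) t) 0 3 1 2)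
      (-sin (l s(0, 3)) * (((x * x' + y * y') * (a * b / (x ^ 2 + y ^ 2) +
        a' * b' / (x' ^ 2 + y' ^ 2)) - (a * b' + b * a')) / |x * y' - y * x'|)) (l s(0, 3)) := by
  have hnd : [(0 : Fin 4), 3, 1, 2].Nodup := by decide
  have hT : TetrahedronExists l := ⟨w, hw⟩
  have hev' := (isOpen_setOf_tetrahedronExists_update hT hnd).mem_nhds
    (hT.update_self s(0, 3))
  have n1 : (s(1, 2) : Sym2 (Fin 4)) ≠ s(0, 3) := by decide
  have n2 : (s(0, 1) : Sym2 (Fin 4)) ≠ s(0, 3) := by decide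
  have n3 : (s(3, 1) : Sym2 (Fin 4)) ≠ s(0, 3) := by decide
  have n4 : (s(0, 2) : Sym2 (Fin 4)) ≠ s(0, 3) := by decide
  have n5 : (s(3, 2) : Sym2 (Fin 4)) ≠ s(0, 3) := by decide
  have h00 : inner ℝ (w 0) (w 0) = (1 : ℝ) := by rw [real_inner_self_eq_norm_sq, hw.1.1]; norm_num
  have h33 : inner ℝ (w 3) (w 3) = (1 : ℝ) := by rw [real_inner_self_eq_norm_sq, hw.1.1]; norm_num
  have h11 : inner ℝ (w 1) (w 1) = (1 : ℝ) := by rw [real_inner_self_eq_norm_sq, hw.1.1]; norm_num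
  have h22 : inner ℝ (w 2) (w 2) = (1 : ℝ) := by rw [real_inner_self_eq_norm_sq, hw.1.1]; norm_num
  have huu : inner ℝ u u = (1 : ℝ) := by rw [real_inner_self_eq_norm_sq, hu]; norm_num
  have hvv : inner ℝ v v = (1 : ℝ) := by rw [real_inner_self_eq_norm_sq, hv]; norm_num
  have h30 : inner ℝ (w 3) (w 0) = inner ℝ (w 0) (w 3) := real_inner_comm _ _
  have hvu : inner ℝ v u = (0 : ℝ) := by rw [real_inner_comm, huv]
  have hue : inner ℝ u (w 0) = (0 : ℝ) := by rw [real_inner_comm, heu]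
  have hve : inner ℝ v (w 0) = (0 : ℝ) := by rw [real_inner_comm, hev]
  have huf : inner ℝ u (w 3) = (0 : ℝ) := by rw [real_inner_comm, hfu]
  have hvf : inner ℝ v (w 3) = (0 : ℝ) := by rw [real_inner_comm, hfv]
  have hX : 0 < 1 - cos (l s(0, 3)) ^ 2 := by
    rw [← sin_sq]
    have := hw.sin_pos (i := 0) (j := 3) (by decide)
    positivity
  have c03 : inner ℝ (w 0) (w 3) = cos (l s(0, 3)) := hw.inner_eq (by decide)
  set X := cos (l s(0, 3)) with hXdef
  have c01 : cos (l s(0, 1)) = a + b * X := by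
    rw [← hw.inner_eq (by decide), h1]
    simp only [inner_add_right, inner_smul_right, h00, c03, heu, hev]; ring
  have c31 : cos (l s(3, 1)) = a * X + b := by
    rw [← hw.inner_eq (by decide), h1]
    simp only [inner_add_right, inner_smul_right, h33, h30, c03, hfu, hfv]; ring
  have c02 : cos (l s(0, 2)) = a' + b' * X := by
    rw [← hw.inner_eq (by decide), h2]
    simp only [inner_add_right, inner_smul_right, h00, c03, heu, hev]; ring
  have c32 : cos (l s(3, 2)) = a' * X + b' := by
    rw [← hw.inner_eq (by decide), h2]
    simp only [inner_add_right, inner_smul_right, h33, h30, c03, hfu, hfv]; ring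
  have c12 : cos (l s(1, 2)) = a * a' + b * b' + X * (a * b' + b * a') + (x * x' + y * y') := by
    rw [← hw.inner_eq (by decide), h1, h2]
    simp only [inner_add_left, inner_add_right, inner_smul_left, inner_smul_right, RCLike.conj_to_real, *]
    ring
  have c11 : 1 = a * a + b * b + X * (a * b + b * a) + (x ^ 2 + y ^ 2) := by
    rw [← h11, h1]
    simp only [inner_add_left, inner_add_right, inner_smul_left, inner_smul_right, RCLike.conj_to_real, h00,
      h33, h30, c03, huu, hvv, huv, hvu, heu, hev, hfu, hfv, hue, hve, huf, hvf]
    ring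
  have c22 : 1 = a' * a' + b' * b' + X * (a' * b' + b' * a') + (x' ^ 2 + y' ^ 2) := by
    rw [← h22, h2]
    simp only [inner_add_left, inner_add_right, inner_smul_left, inner_smul_right, RCLike.conj_to_real, h00,
      h33, h30, c03, huu, hvv, huv, hvu, heu, hev, hfu, hfv, hue, hve, huf, hvf]
    ring
  have q12 := perpInner_combination hX.ne' a b a' b' (x * x' + y * y')
  have q11 := perpInner_combination hX.ne' a b a b (x ^ 2 + y ^ 2)
  have q22 := perpInner_combination hX.ne' a' b' a' b' (x' ^ 2 + y' ^ 2)
  rw [← c12] at q12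
  rw [← c11] at q11
  rw [← c22] at q22
  -- Lagrange's identity: the radicand in the derivative of `arccos` becomes the square of the
  -- planar determinant.
  have hAB : (x ^ 2 + y ^ 2) * (x' ^ 2 + y' ^ 2) - (x * x' + y * y') ^ 2 =
      (x * y' - y * x') ^ 2 := by ring
  have hA : 0 < x ^ 2 + y ^ 2 := by
    rcases eq_or_ne x 0 with rfl | hx
    · have : y ≠ 0 := by rintro rfl; simp at hc
      positivity
    · positivity
  have hB : 0 < x' ^ 2 + y' ^ 2 := by
    rcases eq_or_ne x' 0 with rfl | hx
    · have : y' ≠ 0 := by rintro rfl; simp at hc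
      positivity
    · positivity
  have hd := hasDerivAt_arccos_div_sqrt
    (hasDerivAt_perpInner hX.ne' (cos (l s(1, 2))) a b a' b')
    (hasDerivAt_perpInner hX.ne' 1 a b a b) (hasDerivAt_perpInner hX.ne' 1 a' b' a' b')
    (by rw [q11]; exact hA) (by rw [q22]; exact hB)
    (by rw [q11, q12, q22, hAB]; positivity)
  rw [q11, q12, q22, hAB, sqrt_sq_eq_abs] at hd
  have hd' := hd.comp (l s(0, 3)) (hasDerivAt_cos (l s(0, 3)))
  refine (hd'.congr_deriv ?_).congr_of_eventuallyEq ?_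
  · ring
  · filter_upwards [hev'] with t ht
    rw [exteriorDihedralOfLengths_eq ht hnd]
    simp only [Function.update_self, Function.update_of_ne n1, Function.update_of_ne n2,
      Function.update_of_ne n3, Function.update_of_ne n4, Function.update_of_ne n5,
      c01, c31, c02, c32, sub_sub_cancel, Function.comp_apply]

/-! ### Signs and the sum over the three tetrahedra -/

theorem real_sign_eq_div_abs (r : ℝ) : Real.sign r = r / |r| := by
  rcases lt_trichotomy r 0 with h | rfl | h
  · rw [Real.sign_of_neg h, abs_of_neg h, div_neg, div_self h.ne]
  · simp
  · rw [Real.sign_of_pos h, abs_of_pos h, div_self h.ne']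

theorem orientationSign_eq (o : ℤˣ) (v : Fin 5 → E4) (j : Fin 5) :
    orientationSign o v j = ((o : ℤ) : ℝ) * (-1) ^ (j : ℕ) *
      Real.sign (Matrix.of fun i k : Fin 4 => omitVertex v j i k).det := by
  have h : |((o : ℤ) : ℝ) * (-1) ^ (j : ℕ)| = 1 := by
    rcases Int.units_eq_one_or o with rfl | rfl <;> simp
  rw [orientationSign, real_sign_eq_div_abs, real_sign_eq_div_abs, abs_mul, h, one_mul,
    mul_div_assoc]

/-- Cotangent-sum identity for three vectors `(x k, y k)` in the plane with pairwise
determinants `c k`. -/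
theorem sum_angle_derivatives_eq {a b x y : Fin 3 → ℝ} {c₁ c₂ c₃ : ℝ}
    (e₁ : c₁ = x 1 * y 2 - y 1 * x 2) (e₂ : c₂ = x 0 * y 2 - y 0 * x 2)
    (e₃ : c₃ = x 0 * y 1 - y 0 * x 1) (h₁ : c₁ ≠ 0) (h₂ : c₂ ≠ 0) (h₃ : c₃ ≠ 0)
    {N : Fin 3 → Fin 3 → ℝ}
    (hN : ∀ k l, N k l = (x k * x l + y k * y l) * (a k * b k / (x k ^ 2 + y k ^ 2) +
      a l * b l / (x l ^ 2 + y l ^ 2)) - (a k * b l + b k * a l)) :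
    N 1 2 / c₁ - N 0 2 / c₂ + N 0 1 / c₃ =
      (a 0 * c₁ - a 1 * c₂ + a 2 * c₃) * (b 0 * c₁ - b 1 * c₂ + b 2 * c₃) / (c₁ * c₂ * c₃) := by
  have hpos : ∀ {k l}, x k * y l - y k * x l ≠ 0 → x k ^ 2 + y k ^ 2 ≠ 0 := by
    intro k l h h0
    have hx : x k = 0 := by nlinarith [sq_nonneg (x k), sq_nonneg (y k)]
    have hy : y k = 0 := by nlinarith [sq_nonneg (x k), sq_nonneg (y k)]
    simp [hx, hy] at h
  have hA0 := hpos (e₂ ▸ h₂)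
  have hA1 := hpos (e₁ ▸ h₁)
  have hA2 := hpos (k := 2) (l := 1) (by rw [e₁] at h₁; contrapose! h₁; linarith)
  obtain ⟨E, hE⟩ : ∃ E : Fin 3 → ℝ, ∀ k, E k = a k * b k / (x k ^ 2 + y k ^ 2) := ⟨_, fun _ => rfl⟩
  have f0 : E 0 * (x 0 ^ 2 + y 0 ^ 2) = a 0 * b 0 := by rw [hE]; field_simp
  have f1 : E 1 * (x 1 ^ 2 + y 1 ^ 2) = a 1 * b 1 := by rw [hE]; field_simp
  have f2 : E 2 * (x 2 ^ 2 + y 2 ^ 2) = a 2 * b 2 := by rw [hE]; field_simp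
  simp only [← hE] at hN
  have key : N 1 2 * (c₂ * c₃) - N 0 2 * (c₁ * c₃) + N 0 1 * (c₁ * c₂) =
      (a 0 * c₁ - a 1 * c₂ + a 2 * c₃) * (b 0 * c₁ - b 1 * c₂ + b 2 * c₃) := by
    rw [hN, hN, hN]
    -- `g0`, `g1`, `g2` are the inner products of `c₁ z₀ - c₂ z₁ + c₃ z₂ = 0` with `z₀`, `z₁`, `z₂`,
    -- where `z k = (x k, y k)`. They cancel the denominators in `E` and leave the diagonal terms of
    -- the product.
    have g0 : (x 0 * x 1 + y 0 * y 1) * c₂ - (x 0 * x 2 + y 0 * y 2) * c₃ =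
      (x 0 ^ 2 + y 0 ^ 2) * c₁ := by rw [e₁, e₂, e₃]; ring
    have g1 : (x 1 * x 2 + y 1 * y 2) * c₃ + (x 0 * x 1 + y 0 * y 1) * c₁ =
      (x 1 ^ 2 + y 1 ^ 2) * c₂ := by rw [e₁, e₂, e₃]; ring
    have g2 : (x 1 * x 2 + y 1 * y 2) * c₂ - (x 0 * x 2 + y 0 * y 2) * c₁ =
      (x 2 ^ 2 + y 2 ^ 2) * c₃ := by rw [e₁, e₂, e₃]; ring
    linear_combination E 0 * c₁ * g0 + E 1 * c₂ * g1 + E 2 * c₃ * g2 + c₁ ^ 2 * f0 +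
      c₂ ^ 2 * f1 + c₃ ^ 2 * f2
  rw [← key]
  field_simp

/-- Here `ε` is the orientation of the sphere. The left side carries it once and the right side five
times, which agree as `ε² = 1`; the absolute values from the root are absorbed by the signs. -/
theorem sum_signed_derivatives_eq {ε D P Q c₁ c₂ c₃ n₁ n₂ n₃ S : ℝ} (hε : ε ^ 2 = 1) (hD : D ≠ 0)
    (hP : P ≠ 0) (hQ : Q ≠ 0) (h₁ : c₁ ≠ 0) (h₂ : c₂ ≠ 0) (h₃ : c₃ ≠ 0) (hS : S = |D|)
    (h : n₁ / c₁ - n₂ / c₂ + n₃ / c₃ = P * Q / (c₁ * c₂ * c₃)) :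
    -ε * Real.sign (D * c₁) * (-S * (n₁ / |c₁|)) + (ε * Real.sign (D * c₂) * (-S * (n₂ / |c₂|)) +
      -ε * Real.sign (D * c₃) * (-S * (n₃ / |c₃|))) =
    (ε * Real.sign (D * P)) * (ε * Real.sign (D * Q)) *
      ((-ε * Real.sign (D * c₁)) * (ε * Real.sign (D * c₂)) * (-ε * Real.sign (D * c₃))) *
      (S ^ 2 * √((D * P) ^ 2 * (D * Q) ^ 2 /
        ((D * c₁) ^ 2 * (D * c₂) ^ 2 * (D * c₃) ^ 2))) := by
  have hs : ∀ {c : ℝ}, c ≠ 0 → Real.sign (D * c) / |c| = D / (|D| * c) := by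
    intro c hc
    rw [real_sign_eq_div_abs, abs_mul]
    have h1 := abs_pos.2 hD
    have h2 := abs_pos.2 hc
    field_simp
    rw [sq_abs]
  have hm : ∀ {c : ℝ}, c ≠ 0 → Real.sign c * |c| = c := by
    intro c hc
    rw [real_sign_eq_div_abs, div_mul_cancel₀ _ (abs_ne_zero.2 hc)]
  have hd : ∀ {c : ℝ}, c ≠ 0 → Real.sign c / |c| = 1 / c := by
    intro c hc
    rw [real_sign_eq_div_abs]
    have h2 := abs_pos.2 hc
    field_simp
    rw [sq_abs]
  have hS0 : 0 < |D| := abs_pos.2 hD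
  have hL : -ε * Real.sign (D * c₁) * (-S * (n₁ / |c₁|)) +
      (ε * Real.sign (D * c₂) * (-S * (n₂ / |c₂|)) +
        -ε * Real.sign (D * c₃) * (-S * (n₃ / |c₃|))) =
      ε * D * (n₁ / c₁ - n₂ / c₂ + n₃ / c₃) := by
    calc _ = ε * S * (n₁ * (Real.sign (D * c₁) / |c₁|) - n₂ * (Real.sign (D * c₂) / |c₂|) +
          n₃ * (Real.sign (D * c₃) / |c₃|)) := by ring
      _ = _ := by rw [hs h₁, hs h₂, hs h₃, hS]; field_simp
  have hR : √((D * P) ^ 2 * (D * Q) ^ 2 / ((D * c₁) ^ 2 * (D * c₂) ^ 2 * (D * c₃) ^ 2)) =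
      |D * P| * |D * Q| / (|D * c₁| * |D * c₂| * |D * c₃|) := by
    rw [← mul_pow, ← mul_pow, ← mul_pow, ← div_pow, sqrt_sq_eq_abs]
    simp only [abs_mul, abs_div]
  rw [hL, hR, h]
  calc _ = ε * ((D * P) * (D * Q)) * D ^ 2 * (1 / (D * c₁)) * (1 / (D * c₂)) * (1 / (D * c₃)) := by
        field_simp
    _ = ε * (ε ^ 2) ^ 2 * ((Real.sign (D * P) * |D * P|) * (Real.sign (D * Q) * |D * Q|)) * S ^ 2 *
          (Real.sign (D * c₁) / |D * c₁|) * (Real.sign (D * c₂) / |D * c₂|) *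
          (Real.sign (D * c₃) / |D * c₃|) := by
        rw [hd (mul_ne_zero hD h₁), hd (mul_ne_zero hD h₂), hd (mul_ne_zero hD h₃),
          hm (mul_ne_zero hD hP), hm (mul_ne_zero hD hQ), hε, hS, sq_abs]
        ring
    _ = _ := by ring

theorem hasEdgeLengths_omitVertex {v : Fin 5 → E4} {j : Fin 5}
    (h : IsSphericalTetrahedron (omitVertex v j)) :
    HasEdgeLengths (omitVertex v j) (omitLengths (edgeLength v) j) :=
  ⟨h, fun _ _ _ => rfl⟩

theorem omitLengths_update (l : Sym2 (Fin 5) → ℝ) (j : Fin 5) (a b : Fin 4) (t : ℝ) :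
    omitLengths (Function.update l s(j.succAbove a, j.succAbove b) t) j =
      Function.update (omitLengths l j) s(a, b) t :=
  update_comp_map l Fin.succAbove_right_injective a b t

theorem hasDerivAt_defectAngle (o : ℤˣ) (v : Fin 5 → E4)
    (hv : ∀ i, IsSphericalTetrahedron (omitVertex v i)) :
    HasDerivAt (fun t => defectAngle (orientationSign o v)
        (Function.update (edgeLength v) s(0, 4) t))
      (orientationSign o v 0 * orientationSign o v 4 *
        (orientationSign o v 1 * orientationSign o v 2 * orientationSign o v 3) *
        (sin (edgeLength v s(0, 4)) ^ 2 *
          √(gramDet (omitLengths (edgeLength v) 0) * gramDet (omitLengths (edgeLength v) 4) /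
            (gramDet (omitLengths (edgeLength v) 1) * gramDet (omitLengths (edgeLength v) 2) *
              gramDet (omitLengths (edgeLength v) 3)))))
      (edgeLength v s(0, 4)) := by
  have n0 : ‖v 0‖ = 1 := (hv 1).1 0
  have n4 : ‖v 4‖ = 1 := (hv 1).1 3
  have hli : LinearIndependent ℝ ![v 0, v 4] := (hv 1).2.pair_of_ne (i := 0) (j := 3) (by decide)
  obtain ⟨e, f, he, hf, hef, hve, hvf, hve', hvf', hspan⟩ := exists_orthonormal_complement hli
  choose a b x y hab using hspan
  have hD2 := det_coord_sq_of_orthonormal_complement n0 n4 he hf hef hve hvf hve' hvf'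
  set D := (Matrix.of fun i k : Fin 4 => (![v 0, v 4, e, f] : Fin 4 → E4) i k).det with hD
  have hD0 : D ≠ 0 := by
    have := one_sub_inner_sq_pos_of_linearIndependent n0 n4 hli
    rw [← hD2] at this
    exact sq_pos_iff.1 this
  have hS : sin (edgeLength v s(0, 4)) = |D| := by
    have hnn : 0 ≤ sin (edgeLength v s(0, 4)) :=
      ((hasEdgeLengths_omitVertex (hv 1)).sin_pos (i := 0) (j := 3) (by decide)).le
    rw [← abs_of_nonneg hnn, ← sq_eq_sq_iff_abs_eq_abs, sin_sq, hD2,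
      inner_eq_cos_edgeLength n0 n4]
  set c₁ := x (v 2) * y (v 3) - y (v 2) * x (v 3) with e₁
  set c₂ := x (v 1) * y (v 3) - y (v 1) * x (v 3) with e₂
  set c₃ := x (v 1) * y (v 2) - y (v 1) * x (v 2) with e₃
  -- `P` and `Q` are the 3×3 determinants with rows `(a, x, y)` and `(b, x, y)`, expanded along the
  -- first column.
  set P := a (v 1) * c₁ - a (v 2) * c₂ + a (v 3) * c₃ with hP
  set Q := b (v 1) * c₁ - b (v 2) * c₂ + b (v 3) * c₃ with hQ
  have d0 : (Matrix.of fun i k : Fin 4 => omitVertex v 0 i k).det = D * P := by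
    rw [det_coord_sum_smul !![a (v 1), b (v 1), x (v 1), y (v 1); a (v 2), b (v 2), x (v 2), y (v 2);
      a (v 3), b (v 3), x (v 3), y (v 3); 0, 1, 0, 0] ![v 0, v 4, e, f], ← hD, mul_comm]
    · congr 1
      rw [Matrix.det_succ_row_zero]
      simp [Fin.sum_univ_succ, Matrix.det_fin_three, Fin.succAbove, hP, e₁, e₂, e₃]
      ring
    · intro i
      fin_cases i
      · simpa [Fin.sum_univ_four, omitVertex] using hab (v 1)
      · simpa [Fin.sum_univ_four, omitVertex] using hab (v 2)
      · simpa [Fin.sum_univ_four, omitVertex] using hab (v 3)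
      · simp [Fin.sum_univ_four, omitVertex]
  have d4 : (Matrix.of fun i k : Fin 4 => omitVertex v 4 i k).det = D * Q := by
    rw [det_coord_sum_smul !![1, 0, 0, 0; a (v 1), b (v 1), x (v 1), y (v 1);
      a (v 2), b (v 2), x (v 2), y (v 2);
      a (v 3), b (v 3), x (v 3), y (v 3)] ![v 0, v 4, e, f], ← hD, mul_comm]
    · congr 1
      rw [Matrix.det_succ_row_zero]
      simp [Fin.sum_univ_succ, Matrix.det_fin_three, Fin.succAbove, hQ, e₁, e₂, e₃]
      ring
    · intro i
      fin_cases i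
      · simp [Fin.sum_univ_four, omitVertex]
      · simp [Fin.sum_univ_four]; exact hab (v 1)
      · simp [Fin.sum_univ_four]; exact hab (v 2)
      · simp [Fin.sum_univ_four]; exact hab (v 3)
  -- One computation serves `j = 1, 2, 3`, since in each of these tetrahedra `v 0` and `v 4` occupy
  -- positions 0 and 3.
  have hdet : ∀ (j : Fin 5) (k l : Fin 5), j.succAbove 0 = 0 → j.succAbove 3 = 4 →
      j.succAbove 1 = k → j.succAbove 2 = l →
      (Matrix.of fun i k : Fin 4 => omitVertex v j i k).det =
        D * (x (v k) * y (v l) - y (v k) * x (v l)) := by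
    rintro j k l h0 h3 rfl rfl
    rw [det_coord_sum_smul !![1, 0, 0, 0;
      a (v (j.succAbove 1)), b (v (j.succAbove 1)), x (v (j.succAbove 1)), y (v (j.succAbove 1));
      a (v (j.succAbove 2)), b (v (j.succAbove 2)), x (v (j.succAbove 2)), y (v (j.succAbove 2));
      0, 1, 0, 0] ![v 0, v 4, e, f], ← hD, mul_comm]
    · congr 1
      rw [Matrix.det_succ_row_zero]
      simp [Fin.sum_univ_succ, Matrix.det_fin_three, Fin.succAbove]
    · intro i
      fin_cases i
      · simp [Fin.sum_univ_four, omitVertex, h0]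
      · simpa [Fin.sum_univ_four, omitVertex] using hab (v (j.succAbove 1))
      · simpa [Fin.sum_univ_four, omitVertex] using hab (v (j.succAbove 2))
      · simp [Fin.sum_univ_four, omitVertex, h3]
  have d1 := hdet 1 2 3 (by decide) (by decide) (by decide) (by decide)
  have d2 := hdet 2 1 3 (by decide) (by decide) (by decide) (by decide)
  have d3 := hdet 3 1 2 (by decide) (by decide) (by decide) (by decide)
  rw [← e₁] at d1
  rw [← e₂] at d2
  rw [← e₃] at d3
  have hne := fun j => (linearIndependent_iff_det_coord_ne_zero _).1 (hv j).2
  have hP0 : P ≠ 0 := right_ne_zero_of_mul (d0 ▸ hne 0)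
  have hQ0 : Q ≠ 0 := right_ne_zero_of_mul (d4 ▸ hne 4)
  have h₁ : c₁ ≠ 0 := right_ne_zero_of_mul (d1 ▸ hne 1)
  have h₂ : c₂ ≠ 0 := right_ne_zero_of_mul (d2 ▸ hne 2)
  have h₃ : c₃ ≠ 0 := right_ne_zero_of_mul (d3 ▸ hne 3)
  have hder : ∀ (j : Fin 5) (k l : Fin 5), j.succAbove 0 = 0 → j.succAbove 3 = 4 →
      j.succAbove 1 = k → j.succAbove 2 = l → x (v k) * y (v l) - y (v k) * x (v l) ≠ 0 →
      HasDerivAt (fun t => π - exteriorDihedralOfLengths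
        (omitLengths (Function.update (edgeLength v) s(0, 4) t) j) 0 3 1 2)
        (-|D| * (((x (v k) * x (v l) + y (v k) * y (v l)) *
          (a (v k) * b (v k) / (x (v k) ^ 2 + y (v k) ^ 2) +
            a (v l) * b (v l) / (x (v l) ^ 2 + y (v l) ^ 2)) -
          (a (v k) * b (v l) + b (v k) * a (v l))) /
          |x (v k) * y (v l) - y (v k) * x (v l)|)) (edgeLength v s(0, 4)) := by
    rintro j k l h0 h3 rfl rfl hc
    have w0 : omitVertex v j 0 = v 0 := by rw [omitVertex, h0]
    have w3 : omitVertex v j 3 = v 4 := by rw [omitVertex, h3]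
    have hl : omitLengths (edgeLength v) j s(0, 3) = edgeLength v s(0, 4) := by
      simp [omitLengths, h0, h3]
    have := hasDerivAt_pi_sub_exteriorDihedralOfLengths (hasEdgeLengths_omitVertex (hv j)) he hf hef
      (by rwa [w0]) (by rwa [w0]) (by rwa [w3]) (by rwa [w3])
      (by rw [w0, w3]; exact hab _) (by rw [w0, w3]; exact hab _) hc
    simp only [← omitLengths_update, h0, h3, hl, hS] at this
    exact this
  have D1 := hder 1 2 3 (by decide) (by decide) (by decide) (by decide) h₁
  have D2 := hder 2 1 3 (by decide) (by decide) (by decide) (by decide) h₂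
  have D3 := hder 3 1 2 (by decide) (by decide) (by decide) (by decide) h₃
  have hsum := (D1.const_mul (orientationSign o v 1)).add
    ((D2.const_mul (orientationSign o v 2)).add (D3.const_mul (orientationSign o v 3)))
  have hε : (((o : ℤ) : ℝ)) ^ 2 = 1 := by
    rcases Int.units_eq_one_or o with rfl | rfl <;> simp
  have hG := fun j => (hasEdgeLengths_omitVertex (hv j)).gramDet_eq
  have hid := sum_angle_derivatives_eq (a := ![a (v 1), a (v 2), a (v 3)])
    (b := ![b (v 1), b (v 2), b (v 3)]) (x := ![x (v 1), x (v 2), x (v 3)])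
    (y := ![y (v 1), y (v 2), y (v 3)]) e₁ e₂ e₃ h₁ h₂ h₃ (fun _ _ => rfl)
  have hfin := sum_signed_derivatives_eq hε hD0 hP0 hQ0 h₁ h₂ h₃ rfl hid
  have s0 : orientationSign o v 0 = ((o : ℤ) : ℝ) * Real.sign (D * P) := by
    rw [orientationSign_eq, d0]; simp
  have s1 : orientationSign o v 1 = -((o : ℤ) : ℝ) * Real.sign (D * c₁) := by
    rw [orientationSign_eq, d1]; simp
  have s2 : orientationSign o v 2 = ((o : ℤ) : ℝ) * Real.sign (D * c₂) := by
    rw [orientationSign_eq, d2]; simp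
  have s3 : orientationSign o v 3 = -((o : ℤ) : ℝ) * Real.sign (D * c₃) := by
    rw [orientationSign_eq, d3]; norm_num [pow_succ]
  have s4 : orientationSign o v 4 = ((o : ℤ) : ℝ) * Real.sign (D * Q) := by
    rw [orientationSign_eq, d4]; norm_num [pow_succ]
  rw [hG, hG, hG, hG, hG, d0, d1, d2, d3, d4, hS, s0, s4]
  rw [s1, s2, s3] at hsum ⊢
  refine (hsum.congr_deriv hfin).congr_of_eventuallyEq (Filter.Eventually.of_forall fun t => ?_)
  simp only [defectAngle]
  rw [Finset.sum_insert (by decide), Finset.sum_insert (by decide), Finset.sum_singleton, s1, s2, s3]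
  rfl

/-! ### Gluing along a face and orientation -/

/-- Two tetrahedra that meet exactly in a common face lie on different sides of it. -/
theorem orientationSign_mul_eq_one_of_inter_eq (o : ℤˣ) (v : Fin 5 → E4)
    (hv : ∀ i, IsSphericalTetrahedron (omitVertex v i))
    (h : sphericalSimplex (omitVertex v 0) ∩ sphericalSimplex (omitVertex v 4) =
      sphericalSimplex ![v 1, v 2, v 3]) :
    orientationSign o v 0 * orientationSign o v 4 = 1 := by
  have hli := (hv 4).2
  obtain ⟨c, hc⟩ : ∃ c : Fin 4 → ℝ, v 4 = ∑ i, c i • omitVertex v 4 i := by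
    have htop := hli.span_eq_top_of_card_eq_finrank' (by simp)
    obtain ⟨c, hc⟩ := (Submodule.mem_span_range_iff_exists_fun ℝ).1
      (htop ▸ Submodule.mem_top : v 4 ∈ Submodule.span ℝ (Set.range (omitVertex v 4)))
    exact ⟨c, hc.symm⟩
  -- The minus sign is that of the 4-cycle moving the row of `v 4`, here replaced by its `v 0`
  -- component, to the front.
  have hdet : (Matrix.of fun i k : Fin 4 => omitVertex v 0 i k).det =
      -c 0 * (Matrix.of fun i k : Fin 4 => omitVertex v 4 i k).det := by
    rw [det_coord_sum_smul !![0, 1, 0, 0; 0, 0, 1, 0; 0, 0, 0, 1; c 0, c 1, c 2, c 3]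
      (omitVertex v 4)]
    · congr 1
      rw [Matrix.det_succ_row_zero]
      simp [Fin.sum_univ_succ, Matrix.det_fin_three, Fin.succAbove]
    · intro i
      fin_cases i
      · simp [Fin.sum_univ_four]; rfl
      · simp [Fin.sum_univ_four]; rfl
      · simp [Fin.sum_univ_four]; rfl
      · simp [Fin.sum_univ_four]; exact hc.trans (Fin.sum_univ_four _)
  have h0 := (linearIndependent_iff_det_coord_ne_zero _).1 (hv 0).2
  have h4 := (linearIndependent_iff_det_coord_ne_zero _).1 hli
  obtain ⟨d, hd⟩ : ∃ d, (Matrix.of fun i k : Fin 4 => omitVertex v 4 i k).det = d := ⟨_, rfl⟩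
  rw [hd] at hdet h4
  have hc0 : c 0 < 0 := by
    by_contra! hnn
    have hpos : 0 < c 0 := lt_of_le_of_ne hnn fun h => h0 (by rw [hdet, ← h]; simp)
    obtain ⟨K, hK0, hK⟩ : ∃ K : ℝ, 0 ≤ K ∧ ∀ i, 0 ≤ K + c i :=
      ⟨∑ i, |c i|, by positivity, fun i => by
        have := Finset.single_le_sum (f := fun i => |c i|) (fun i _ => abs_nonneg _)
          (Finset.mem_univ i)
        linarith [neg_abs_le (c i)]⟩
    -- If `v 4` were on the same side of the face as `v 0`, then for large `K` this point, once
    -- normalized, would lie in both tetrahedra. Its `v 0` coefficient `c 0 > 0` keeps it off the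
    -- common face.
    set z := K • v 1 + K • v 2 + K • v 3 + v 4 with hz
    have hz4 : z = ∑ i, (![c 0, K + c 1, K + c 2, K + c 3] : Fin 4 → ℝ) i • omitVertex v 4 i := by
      rw [hz, hc]
      have t1 : v 1 = omitVertex v 4 1 := rfl
      have t2 : v 2 = omitVertex v 4 2 := rfl
      have t3 : v 3 = omitVertex v 4 3 := rfl
      rw [t1, t2, t3]
      simp [Fin.sum_univ_four]
      module
    have hz0 : z ≠ 0 := by
      intro hzero
      rw [hz4] at hzero
      exact hpos.ne' (Fintype.linearIndependent_iff.1 hli _ hzero 0)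
    have hn : 0 < ‖z‖ := norm_pos_iff.2 hz0
    have hnorm : ‖‖z‖⁻¹ • z‖ = 1 := by
      rw [norm_smul, norm_inv, norm_norm, inv_mul_cancel₀ hn.ne']
    have hmem : ‖z‖⁻¹ • z ∈ sphericalSimplex ![v 1, v 2, v 3] := by
      rw [← h]
      refine ⟨⟨hnorm, fun i => ‖z‖⁻¹ * (![K, K, K, 1] : Fin 4 → ℝ) i, fun i => ?_, ?_⟩,
        ⟨hnorm, fun i => ‖z‖⁻¹ * (![c 0, K + c 1, K + c 2, K + c 3] : Fin 4 → ℝ) i,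
          fun i => ?_, ?_⟩⟩
      · refine mul_nonneg (by positivity) ?_
        fin_cases i <;> simp [hK0]
      · simp only [mul_smul, ← Finset.smul_sum]
        congr 1
        simp [Fin.sum_univ_four, hz]
        rfl
      · refine mul_nonneg (by positivity) ?_
        fin_cases i <;> simp [hK, hpos.le]
      · simp only [mul_smul, ← Finset.smul_sum]
        rw [← hz4]
    obtain ⟨-, g, -, hg⟩ := hmem
    have hzero : ∑ i, (‖z‖⁻¹ * (![c 0, K + c 1, K + c 2, K + c 3] : Fin 4 → ℝ) i -
        (![0, g 0, g 1, g 2] : Fin 4 → ℝ) i) • omitVertex v 4 i = 0 := by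
      simp only [sub_smul, Finset.sum_sub_distrib, mul_smul, ← Finset.smul_sum]
      rw [← hz4, hg]
      simp [Fin.sum_univ_four, Fin.sum_univ_three, omitVertex]
      exact sub_self _
    have := Fintype.linearIndependent_iff.1 hli _ hzero 0
    simp [hpos.ne', hn.ne'] at this
  rw [orientationSign_eq, orientationSign_eq, hdet, hd, real_sign_eq_div_abs, real_sign_eq_div_abs,
    abs_mul, abs_neg, abs_of_neg hc0]
  have hd0 : |d| ≠ 0 := abs_ne_zero.2 h4
  have hε : (((o : ℤ) : ℝ)) ^ 2 = 1 := by
    rcases Int.units_eq_one_or o with rfl | rfl <;> simp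
  have hc0' := hc0.ne
  rw [Fin.val_zero, show ((4 : Fin 5) : ℕ) = 4 from rfl]
  field_simp
  rw [hε, sq_abs]
  norm_num

theorem mainTheorem1 :
    -- the asymptotic pentagon identity
    (∀ (o : ℤˣ) (v : Fin 5 → E4), (∀ i, IsSphericalTetrahedron (omitVertex v i)) →
      ∀ (s : Fin 5 → ℝ) (G : Fin 5 → ℝ) (y : ℝ),
        s = orientationSign o v →
        G = (fun i => gramDet (omitLengths (edgeLength v) i)) →
        y = edgeLength v s(0, 4) →
        -- the two tetrahedra `S_0`, `S_4` glued along their common face, as in the 2-3 move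
        (sphericalSimplex (omitVertex v 0) ∩ sphericalSimplex (omitVertex v 4) =
            sphericalSimplex ![v 1, v 2, v 3] →
          HasDerivAt (fun t => defectAngle s (Function.update (edgeLength v) s(0, 4) t))
            (s 1 * s 2 * s 3 * (sin y ^ 2 * √(G 0 * G 4 / (G 1 * G 2 * G 3)))) y) ∧
        -- all positions of the five points
        HasDerivAt (fun t => defectAngle s (Function.update (edgeLength v) s(0, 4) t))
          (s 0 * s 4 * (s 1 * s 2 * s 3) *
            (sin y ^ 2 * √(G 0 * G 4 / (G 1 * G 2 * G 3)))) y) ∧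
    -- the asymptotic normalization identity
    (∀ (l : Sym2 (Fin 4) → ℝ), TetrahedronExists l →
      ∀ a b c d : Fin 4, [a, b, c, d].Nodup →
        MeasureTheory.IntegrableOn
          (fun t => sin t / √(gramDet (Function.update l s(a, b) t)))
          {t : ℝ | TetrahedronExists (Function.update l s(a, b) t)} ∧
        sin (l s(c, d)) *
          (∫ t in {t : ℝ | TetrahedronExists (Function.update l s(a, b) t)},
            sin t / √(gramDet (Function.update l s(a, b) t))) = π) := by
  refine ⟨?_, fun l hl a b c d hnd => integral_sin_div_sqrt_gramDet_update_of_nodup hl hnd⟩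
  rintro o v hv s G y rfl rfl rfl
  have hd := hasDerivAt_defectAngle o v hv
  refine ⟨fun h => ?_, hd⟩
  rwa [orientationSign_mul_eq_one_of_inter_eq o v hv h, one_mul] at hd
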